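/- Let $\Theta$ be a Polish space, equipped with a metric inducing its topology and with its Borel $\sigma$-algebra. A measure on $\Theta$ is called locally finite if it is finite on every set of bounded diameter; random measures are random elements of the set of locally finite measures. Let $\mathrm{BM}_+(\Theta)$ be the set of measurable, nonnegative, bounded functions on $\Theta$ with bounded support. For a locally finite measure $H$ and $b>0$, write $W\sim \mathrm{GaP}(H,b)$ if the random measure $W$ has Laplace functional $$\mathrm{E}\big(e^{-\int_\Theta f\,\mathrm{d}W}\big)=\exp\Big(-\int_\Theta \log\big(1+f/b\big)\,\mathrm{d}H\Big),\qquad f\in \mathrm{BM}_+(\Theta).$$ Let $(W_t)_{t\ge 1}$ be an M-ARG(1) process on $\Theta$ with locally finite base measure $H$ and parameters $\beta_t>0$, $c_t>0$ ($t\ge 2$), that is, a Markov process of random measures, with arbitrary (possibly random) locally finite initial condition $W_1$, such that for every $t\ge 1$ and every $f\in\mathrm{BM}_+(\Theta)$, almost surely, $$\mathrm{E}\big(e^{-\int_\Theta f\,\mathrm{d}W_{t+1}}\mid W_t\big)=\exp\Big(-\int_\Theta\log(1+c_{t+1}f)\,\mathrm{d}H-\int_\Theta\frac{c_{t+1}f}{1+c_{t+1}f}\,\beta_{t+1}\,\mathrm{d}W_t\Big).$$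 If $c_{t+1}=c$ and $\beta_{t+1}=\beta$ for all $t\ge1$ and $\rho=\beta c<1$, then for every $t\ge 1$ and every $f\in\mathrm{BM}_+(\Theta)$, almost surely, $$\lim_{h\to+\infty}\mathrm{E}\big(e^{-\int_\Theta f\,\mathrm{d}W_{t+h}}\mid W_t\big)=\exp\Big(-\int_\Theta\log\Big(1+\frac{c}{1-\rho}f\Big)\,\mathrm{d}H\Big),$$ the right-hand side being the Laplace functional of $\mathrm{GaP}(H,(1-\rho)/c)$. Moreover, this limiting distribution is invariant: for every $t\ge 1$, if $W_t\sim \mathrm{GaP}(H,(1-\rho)/c)$, then $W_{t+h}\sim\mathrm{GaP}(H,(1-\rho)/c)$ for every $h\ge1$. -/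

import Mathlib

open MeasureTheory Filter Topology

namespace MARG

/-- Locally finite measures on a metric space: every set of bounded diameter has finite measure. -/
def IsLocFinite {Θ : Type*} [MetricSpace Θ] [MeasurableSpace Θ] (ν : Measure Θ) : Prop :=
  ∀ s : Set Θ, Bornology.IsBounded s → ν s < ⊤

/-- The class `BM₊(Θ)` of measurable, nonnegative, bounded functions with bounded support. -/
structure BMPos {Θ : Type*} [MetricSpace Θ] [MeasurableSpace Θ] (f : Θ → ℝ) : Prop where
  measurable : Measurable f
  nonneg : ∀ θ, 0 ≤ f θ
  bounded : ∃ C : ℝ, ∀ θ, f θ ≤ C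
  bounded_support : Bornology.IsBounded (Function.support f)

/-- `W` is a (locally finite) random measure on `Θ`, defined on `(Ω, P)`. The measurability is with
respect to the σ-algebra on `Measure Θ` generated by the evaluations `ν ↦ ν A`, `A` measurable. -/
structure IsRandomMeasure {Ω Θ : Type*} [MeasurableSpace Ω] [MetricSpace Θ] [MeasurableSpace Θ]
    (P : Measure Ω) (W : Ω → Measure Θ) : Prop where
  measurable : Measurable W
  locFinite : ∀ᵐ ω ∂P, IsLocFinite (W ω)

/-- The Laplace functional `E (exp (-∫ f dW))` of a random measure `W`. -/
noncomputable def laplace {Ω Θ : Type*} [MeasurableSpace Ω] [MeasurableSpace Θ]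
    (P : Measure Ω) (W : Ω → Measure Θ) (f : Θ → ℝ) : ℝ :=
  ∫ ω, Real.exp (-∫ θ, f θ ∂(W ω)) ∂P

/-- The conditional Laplace functional `E (exp (-∫ f dM) | N)` of a random measure `M` given a
random measure `N`, as a random variable: conditional expectation given the σ-algebra of `N`. -/
noncomputable def condLaplace {Ω Θ : Type*} [MeasurableSpace Ω] [MeasurableSpace Θ]
    (P : Measure Ω) (M N : Ω → Measure Θ) (f : Θ → ℝ) : Ω → ℝ :=
  P[fun ω => Real.exp (-∫ θ, f θ ∂(M ω)) | MeasurableSpace.comap N inferInstance]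

/-- `W ∼ GaP(H, b)`: `W` is a gamma random measure with base measure `H` and rate `b > 0`,
characterised by its Laplace functional. -/
structure IsGammaProcess {Ω Θ : Type*} [MeasurableSpace Ω] [MetricSpace Θ] [MeasurableSpace Θ]
    (P : Measure Ω) (W : Ω → Measure Θ) (H : Measure Θ) (b : ℝ) : Prop where
  randomMeasure : IsRandomMeasure P W
  laplace_eq : ∀ f : Θ → ℝ, BMPos f →
    laplace P W f = Real.exp (-∫ θ, Real.log (1 + f θ / b) ∂H)

/-- The Laplace functional of the noncentral gamma process `NcGaP(H, M, c⁻¹)`. -/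
noncomputable def ncGammaLaplace {Θ : Type*} [MeasurableSpace Θ]
    (H M : Measure Θ) (c : ℝ) (f : Θ → ℝ) : ℝ :=
  Real.exp (-(∫ θ, Real.log (1 + c * f θ) ∂H) - ∫ θ, c * f θ / (1 + c * f θ) ∂M)

/-- The Markov property of a process `(W t)_{t ≥ 1}` with values in the measures on `Θ`: for every
bounded measurable `g`, `E (g (W (t+1)) | W 1, …, W t) = E (g (W (t+1)) | W t)` a.s. -/
def IsMarkov {Ω Θ : Type*} [MeasurableSpace Ω] [MeasurableSpace Θ]
    (P : Measure Ω) (W : ℕ → Ω → Measure Θ) : Prop :=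
  ∀ t : ℕ, 1 ≤ t → ∀ g : Measure Θ → ℝ, Measurable g → (∃ C : ℝ, ∀ ν, |g ν| ≤ C) →
    P[fun ω => g (W (t + 1) ω) | ⨆ s ∈ Set.Icc 1 t, MeasurableSpace.comap (W s) inferInstance]
      =ᵐ[P] P[fun ω => g (W (t + 1) ω) | MeasurableSpace.comap (W t) inferInstance]

/-- `(W t)_{t ≥ 1}` is an M-ARG(1) process with base measure `H` and parameters
`(β t, c t)_{t ≥ 2}`: a Markov process of locally finite random measures such that, given `W t`,
the random measure `W (t+1)` is `NcGaP(H, β (t+1) • W t, (c (t+1))⁻¹)`. The initial condition `W 1`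
is arbitrary, and the values at `t = 0` (and of `β`, `c` at `t = 1`) play no role. -/
structure IsMARG {Ω Θ : Type*} [MeasurableSpace Ω] [MetricSpace Θ] [MeasurableSpace Θ]
    (P : Measure Ω) (H : Measure Θ) (β c : ℕ → ℝ) (W : ℕ → Ω → Measure Θ) : Prop where
  beta_pos : ∀ t : ℕ, 2 ≤ t → 0 < β t
  c_pos : ∀ t : ℕ, 2 ≤ t → 0 < c t
  base_locFinite : IsLocFinite H
  randomMeasure : ∀ t : ℕ, 1 ≤ t → IsRandomMeasure P (W t)
  markov : IsMarkov P W
  transition : ∀ t : ℕ, 1 ≤ t → ∀ f : Θ → ℝ, BMPos f →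
    condLaplace P (W (t + 1)) (W t) f
      =ᵐ[P] fun ω => ncGammaLaplace H (ENNReal.ofReal (β (t + 1)) • W t ω) (c (t + 1)) f

end MARG

/-! One transition turns `exp (-∫ f dW)` at time `t + 1` into a constant times the same functional
at time `t`, with `f` replaced pointwise by its image under `T x = ρ x / (1 + c x)`. By the Markov
and tower properties, `n` transitions iterate `T`. Since `T` is fractional linear, `T^n x = ρ^n x /
(1 + s_n x)` with `s_n = ∑_{k<n} c ρ^k`, and `1 + (c + ρ s) x = (1 + c x) (1 + s T x)` collects the
constants into `log (1 + s_n f)`. As `ρ < 1`, the dependence on the starting measure dies out with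
`ρ^n`, while `s_n` tends to `c / (1 - ρ)`. This limit is the fixed point of `s ↦ c + ρ s`, whence
invariance. -/

namespace MARG

section BMPos

variable {Θ : Type*} [MetricSpace Θ] [MeasurableSpace Θ] {f : Θ → ℝ}

/-- The image of `f` under the fractional linear map `x ↦ a * x / (1 + b * x)`. -/
noncomputable def moebius (a b : ℝ) (f : Θ → ℝ) : Θ → ℝ := fun θ => a * f θ / (1 + b * f θ)

theorem BMPos.integrable (hf : BMPos f) {ν : Measure Θ} (hν : IsLocFinite ν) :
    Integrable f ν := by
  obtain ⟨C, hC⟩ := hf.bounded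
  rw [← integrableOn_iff_integrable_of_support_subset (subset_refl (Function.support f))]
  refine Measure.integrableOn_of_bounded (M := C) (hν _ hf.bounded_support).ne
    hf.measurable.aestronglyMeasurable (Eventually.of_forall fun θ => ?_)
  rw [Real.norm_of_nonneg (hf.nonneg θ)]
  exact hC θ

theorem BMPos.moebius (hf : BMPos f) {a b : ℝ} (ha : 0 ≤ a) (hb : 0 ≤ b) :
    BMPos (moebius a b f) where
  measurable := (hf.measurable.const_mul a).div ((hf.measurable.const_mul b).const_add 1)
  nonneg θ := by
    have := hf.nonneg θ
    unfold MARG.moebius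
    positivity
  bounded := by
    obtain ⟨C, hC⟩ := hf.bounded
    refine ⟨a * C, fun θ => ?_⟩
    have h0 := hf.nonneg θ
    have h1 : 0 ≤ b * f θ := mul_nonneg hb h0
    exact (div_le_self (mul_nonneg ha h0) (by linarith)).trans
      (mul_le_mul_of_nonneg_left (hC θ) ha)
  bounded_support := by
    refine hf.bounded_support.subset fun θ hθ => ?_
    contrapose! hθ
    simp [MARG.moebius, Function.notMem_support.1 hθ]

theorem BMPos.norm_log_le (hf : BMPos f) {s : ℝ} (hs : 0 ≤ s) (θ : Θ) :
    ‖Real.log (1 + s * f θ)‖ ≤ s * f θ := by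
  have h := mul_nonneg hs (hf.nonneg θ)
  rw [Real.norm_of_nonneg (Real.log_nonneg (by linarith))]
  linarith [Real.log_le_sub_one_of_pos (show 0 < 1 + s * f θ by linarith)]

theorem BMPos.measurable_log (hf : BMPos f) (s : ℝ) :
    Measurable fun θ => Real.log (1 + s * f θ) :=
  ((hf.measurable.const_mul s).const_add 1).log

theorem BMPos.integrable_log (hf : BMPos f) {ν : Measure Θ} (hν : IsLocFinite ν) {s : ℝ}
    (hs : 0 ≤ s) : Integrable (fun θ => Real.log (1 + s * f θ)) ν :=
  ((hf.integrable hν).const_mul s).mono' (hf.measurable_log s).aestronglyMeasurable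
    (Eventually.of_forall (hf.norm_log_le hs))

theorem BMPos.measurable_exp_neg_integral (hf : BMPos f) :
    Measurable fun ν : Measure Θ => Real.exp (-∫ θ, f θ ∂ν) := by
  -- Valid for every `ν`: if `f` has infinite integral, both sides use the value `0`.
  have h : (fun ν : Measure Θ => Real.exp (-∫ θ, f θ ∂ν)) =
      fun ν => Real.exp (-(∫⁻ θ, ENNReal.ofReal (f θ) ∂ν).toReal) := by
    funext ν
    rw [integral_eq_lintegral_of_nonneg_ae (Eventually.of_forall hf.nonneg)
      hf.measurable.aestronglyMeasurable]
  rw [h]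
  exact (Measure.measurable_lintegral hf.measurable.ennreal_ofReal).ennreal_toReal.neg.exp

theorem BMPos.abs_exp_neg_integral_le (hf : BMPos f) (ν : Measure Θ) :
    |Real.exp (-∫ θ, f θ ∂ν)| ≤ 1 := by
  rw [abs_of_pos (Real.exp_pos _), Real.exp_le_one_iff]
  have h : 0 ≤ ∫ θ, f θ ∂ν := integral_nonneg hf.nonneg
  linarith

/-- Composition law of the logarithmic exponents along two consecutive transitions. -/
theorem BMPos.integral_log_moebius (hf : BMPos f) {ν : Measure Θ} (hν : IsLocFinite ν)
    {c ρ s : ℝ} (hc : 0 ≤ c) (hρ : 0 ≤ ρ) (hs : 0 ≤ s) :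
    ∫ θ, Real.log (1 + (c + ρ * s) * f θ) ∂ν =
      (∫ θ, Real.log (1 + c * f θ) ∂ν) +
        ∫ θ, Real.log (1 + s * MARG.moebius ρ c f θ) ∂ν := by
  rw [← integral_add (hf.integrable_log hν hc) ((hf.moebius hρ hc).integrable_log hν hs)]
  refine integral_congr_ae (Eventually.of_forall fun θ => ?_)
  have h1 : 0 < 1 + c * f θ := by have := mul_nonneg hc (hf.nonneg θ); linarith
  have h2 : 0 < 1 + s * MARG.moebius ρ c f θ := by
    have := mul_nonneg hs ((hf.moebius hρ hc).nonneg θ); linarith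
  dsimp only
  rw [← Real.log_mul h1.ne' h2.ne']
  congr 1
  unfold MARG.moebius
  field_simp
  ring

/-- Composition is the product of the lower triangular matrices `[[r, 0], [s, 1]]` and `[[ρ, 0], [c,
1]]`. -/
theorem BMPos.moebius_moebius (hf : BMPos f) {c ρ r s : ℝ} (hc : 0 ≤ c) (hρ : 0 ≤ ρ)
    (hs : 0 ≤ s) :
    MARG.moebius r s (MARG.moebius ρ c f) = MARG.moebius (r * ρ) (c + ρ * s) f := by
  funext θ
  have h0 := hf.nonneg θ
  have h1 : 0 < 1 + c * f θ := by positivity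
  have h2 : 0 < 1 + (c + ρ * s) * f θ := by positivity
  unfold MARG.moebius
  have h3 : 1 + s * (ρ * f θ / (1 + c * f θ)) = (1 + (c + ρ * s) * f θ) / (1 + c * f θ) := by
    field_simp
    ring
  rw [h3]
  field_simp

end BMPos

section Transition

variable {Θ Ω : Type*} [MetricSpace Θ] [MeasurableSpace Θ] {mΩ : MeasurableSpace Ω}
  {P : Measure Ω} {H : Measure Θ} {W : ℕ → Ω → Measure Θ}
  {βseq cseq : ℕ → ℝ} {β c ρ : ℝ}

theorem IsMARG.condLaplace_succ (hW : IsMARG P H βseq cseq W)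
    (hβ : ∀ t : ℕ, 1 ≤ t → βseq (t + 1) = β) (hc : ∀ t : ℕ, 1 ≤ t → cseq (t + 1) = c)
    (hρ : ρ = β * c) {t : ℕ} (ht : 1 ≤ t) {f : Θ → ℝ} (hf : BMPos f) :
    condLaplace P (W (t + 1)) (W t) f =ᵐ[P] fun ω =>
      Real.exp (-∫ θ, Real.log (1 + c * f θ) ∂H) *
        Real.exp (-∫ θ, moebius ρ c f θ ∂(W t ω)) := by
  have hβ0 : 0 ≤ β := hβ t ht ▸ (hW.beta_pos (t + 1) (by omega)).le
  filter_upwards [hW.transition t ht f hf] with ω hω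
  rw [hω, ncGammaLaplace, hβ t ht, hc t ht, integral_smul_measure, ENNReal.toReal_ofReal hβ0,
    smul_eq_mul, ← integral_const_mul, ← Real.exp_add, sub_eq_add_neg]
  congr 4
  funext θ
  rw [moebius, hρ]
  ring

/-- Induction peels off the last transition, which replaces `f` by `moebius ρ c f`; hence `f` is
generalized. -/
theorem IsMARG.condLaplace_add [IsProbabilityMeasure P] (hW : IsMARG P H βseq cseq W)
    (hβ : ∀ t : ℕ, 1 ≤ t → βseq (t + 1) = β) (hc : ∀ t : ℕ, 1 ≤ t → cseq (t + 1) = c)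
    (hρ : ρ = β * c) {t : ℕ} (ht : 1 ≤ t) (h : ℕ) {f : Θ → ℝ} (hf : BMPos f) :
    condLaplace P (W (t + (h + 1))) (W t) f =ᵐ[P] fun ω =>
      Real.exp (-∫ θ, Real.log (1 + (∑ k ∈ Finset.range (h + 1), c * ρ ^ k) * f θ) ∂H) *
        Real.exp (-∫ θ, moebius (ρ ^ (h + 1)) (∑ k ∈ Finset.range (h + 1), c * ρ ^ k) f θ
          ∂(W t ω)) := by
  have hβ0 : 0 ≤ β := hβ t ht ▸ (hW.beta_pos (t + 1) (by omega)).le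
  have hc0 : 0 ≤ c := hc t ht ▸ (hW.c_pos (t + 1) (by omega)).le
  have hρ0 : 0 ≤ ρ := hρ ▸ mul_nonneg hβ0 hc0
  induction h generalizing f with
  | zero => simpa using hW.condLaplace_succ hβ hc hρ ht hf
  | succ h ih =>
    set s := ∑ k ∈ Finset.range (h + 1), c * ρ ^ k with hs
    have hs0 : 0 ≤ s := Finset.sum_nonneg fun k _ => by positivity
    have hsucc : ∑ k ∈ Finset.range (h + 1 + 1), c * ρ ^ k = c + ρ * s := by
      rw [Finset.sum_range_succ', hs, Finset.mul_sum, add_comm]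
      congr 1
      · simp
      · exact Finset.sum_congr rfl fun k _ => by ring
    have hg := hf.moebius hρ0 hc0
    -- The tower property goes through the whole past up to `t + (h + 1)`: unlike the σ-algebra of
    -- the last state alone, it contains that of `W t`.
    have hFle : ⨆ r ∈ Set.Icc 1 (t + (h + 1)), MeasurableSpace.comap (W r) inferInstance ≤ mΩ :=
      iSup₂_le fun r hr => (hW.randomMeasure r hr.1).measurable.comap_le
    have hle : MeasurableSpace.comap (W t) inferInstance ≤
        ⨆ r ∈ Set.Icc 1 (t + (h + 1)), MeasurableSpace.comap (W r) inferInstance :=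
      le_iSup₂_of_le (f := fun r (_ : r ∈ Set.Icc 1 (t + (h + 1))) =>
        MeasurableSpace.comap (W r) inferInstance) t ⟨ht, by omega⟩ le_rfl
    have hlast := (hW.markov (t + (h + 1)) (by omega) _ hf.measurable_exp_neg_integral
      ⟨1, hf.abs_exp_neg_integral_le⟩).trans (hW.condLaplace_succ hβ hc hρ (by omega) hf)
    have htower := (condExp_condExp_of_le (μ := P)
      (f := fun ω => Real.exp (-∫ θ, f θ ∂(W (t + (h + 1) + 1) ω))) hle hFle).symm.trans
      (condExp_congr_ae hlast)
    have hmul := condExp_smul (μ := P) (Real.exp (-∫ θ, Real.log (1 + c * f θ) ∂H))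
      (fun ω => Real.exp (-∫ θ, moebius ρ c f θ ∂(W (t + (h + 1)) ω)))
      (MeasurableSpace.comap (W t) inferInstance)
    filter_upwards [htower.trans hmul, ih hg] with ω h1 h2
    refine h1.trans ?_
    rw [Pi.smul_apply, smul_eq_mul]
    refine (congrArg _ h2).trans ?_
    rw [hsucc, hf.integral_log_moebius hW.base_locFinite hc0 hρ0 hs0,
      hf.moebius_moebius hc0 hρ0 hs0, ← pow_succ, neg_add, Real.exp_add, mul_assoc]

theorem IsMARG.isGammaProcess_succ [IsProbabilityMeasure P] (hW : IsMARG P H βseq cseq W)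
    (hβ : ∀ t : ℕ, 1 ≤ t → βseq (t + 1) = β) (hc : ∀ t : ℕ, 1 ≤ t → cseq (t + 1) = c)
    (hρ : ρ = β * c) (hρ1 : ρ < 1) {t : ℕ} (ht : 1 ≤ t)
    (hG : IsGammaProcess P (W t) H ((1 - ρ) / c)) :
    IsGammaProcess P (W (t + 1)) H ((1 - ρ) / c) where
  randomMeasure := hW.randomMeasure (t + 1) (by omega)
  laplace_eq f hf := by
    have hβ0 : 0 < β := hβ t ht ▸ hW.beta_pos (t + 1) (by omega)
    have hc0 : 0 < c := hc t ht ▸ hW.c_pos (t + 1) (by omega)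
    have hρ0 : 0 ≤ ρ := hρ ▸ (mul_pos hβ0 hc0).le
    have hρ' : 0 < 1 - ρ := by linarith
    have hs0 : 0 ≤ c / (1 - ρ) := by positivity
    have hdiv : ∀ x : ℝ, x / ((1 - ρ) / c) = c / (1 - ρ) * x := fun x => by field_simp
    -- With this fixed point, the constant of the transition and the gamma functional at `moebius ρ
    -- c f` recombine into the gamma functional at `f`.
    have hfix : c / (1 - ρ) = c + ρ * (c / (1 - ρ)) := by field_simp; ring
    have hG' := hG.laplace_eq _ (hf.moebius hρ0 hc0.le)
    simp only [hdiv, laplace] at hG' ⊢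
    rw [← integral_condExp (hW.randomMeasure t ht).measurable.comap_le]
    refine (integral_congr_ae (hW.condLaplace_succ hβ hc hρ ht hf)).trans ?_
    rw [integral_const_mul, hG', ← Real.exp_add, ← neg_add,
      ← hf.integral_log_moebius hW.base_locFinite hc0.le hρ0 hs0, ← hfix]

/-- Dominated convergence, with `log (1 + x) ≤ x` giving the integrable bound `b * f`. -/
theorem BMPos.tendsto_integral_log {f : Θ → ℝ} (hf : BMPos f) {ν : Measure Θ}
    (hν : IsLocFinite ν) {s : ℕ → ℝ} {b : ℝ} (hs : ∀ n, 0 ≤ s n) (hsb : ∀ n, s n ≤ b)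
    (hlim : Tendsto s atTop (𝓝 b)) :
    Tendsto (fun n => ∫ θ, Real.log (1 + s n * f θ) ∂ν) atTop
      (𝓝 (∫ θ, Real.log (1 + b * f θ) ∂ν)) := by
  refine tendsto_integral_of_dominated_convergence (fun θ => b * f θ)
    (fun n => (hf.measurable_log (s n)).aestronglyMeasurable)
    ((hf.integrable hν).const_mul b) (fun n => Eventually.of_forall fun θ => ?_)
    (Eventually.of_forall fun θ => ?_)
  · exact (hf.norm_log_le (hs n) θ).trans (mul_le_mul_of_nonneg_right (hsb n) (hf.nonneg θ))
  · have hb : 0 ≤ b * f θ := mul_nonneg ((hs 0).trans (hsb 0)) (hf.nonneg θ)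
    exact ((hlim.mul_const (f θ)).const_add 1).log (by linarith)

/-- The integrand is at most `a n * f`, so no upper bound on `s n` is needed. -/
theorem BMPos.tendsto_integral_moebius {f : Θ → ℝ} (hf : BMPos f) {ν : Measure Θ}
    (hν : IsLocFinite ν) {a s : ℕ → ℝ} (ha : ∀ n, 0 ≤ a n) (hs : ∀ n, 0 ≤ s n)
    (hlim : Tendsto a atTop (𝓝 0)) :
    Tendsto (fun n => ∫ θ, MARG.moebius (a n) (s n) f θ ∂ν) atTop (𝓝 0) := by
  refine squeeze_zero (fun n => integral_nonneg (hf.moebius (ha n) (hs n)).nonneg)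
    (fun n => ?_) (by simpa using hlim.mul_const (∫ θ, f θ ∂ν))
  rw [← integral_const_mul]
  refine integral_mono ((hf.moebius (ha n) (hs n)).integrable hν)
    ((hf.integrable hν).const_mul (a n)) fun θ => ?_
  exact div_le_self (mul_nonneg (ha n) (hf.nonneg θ))
    (by linarith [mul_nonneg (hs n) (hf.nonneg θ)])

theorem IsMARG.tendsto_condLaplace [IsProbabilityMeasure P] (hW : IsMARG P H βseq cseq W)
    (hβ : ∀ t : ℕ, 1 ≤ t → βseq (t + 1) = β) (hc : ∀ t : ℕ, 1 ≤ t → cseq (t + 1) = c)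
    (hρ : ρ = β * c) (hρ1 : ρ < 1) {t : ℕ} (ht : 1 ≤ t) {f : Θ → ℝ} (hf : BMPos f) :
    ∀ᵐ ω ∂P, Tendsto (fun h : ℕ => condLaplace P (W (t + h)) (W t) f ω) atTop
      (𝓝 (Real.exp (-∫ θ, Real.log (1 + c / (1 - ρ) * f θ) ∂H))) := by
  have hβ0 : 0 ≤ β := hβ t ht ▸ (hW.beta_pos (t + 1) (by omega)).le
  have hc0 : 0 ≤ c := hc t ht ▸ (hW.c_pos (t + 1) (by omega)).le
  have hρ0 : 0 ≤ ρ := hρ ▸ mul_nonneg hβ0 hc0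
  have hterm : ∀ k : ℕ, 0 ≤ c * ρ ^ k := fun k => by positivity
  have hsum : HasSum (fun k => c * ρ ^ k) (c / (1 - ρ)) :=
    (hasSum_geometric_of_lt_one hρ0 hρ1).mul_left c
  have hs0 : ∀ n, 0 ≤ ∑ k ∈ Finset.range (n + 1), c * ρ ^ k :=
    fun n => Finset.sum_nonneg fun k _ => hterm k
  have hlog := hf.tendsto_integral_log hW.base_locFinite hs0
    (fun n => sum_le_hasSum _ (fun k _ => hterm k) hsum)
    ((tendsto_add_atTop_iff_nat 1).2 hsum.tendsto_sum_nat)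
  have hpow : Tendsto (fun n => ρ ^ (n + 1)) atTop (𝓝 0) :=
    (tendsto_add_atTop_iff_nat 1).2 (tendsto_pow_atTop_nhds_zero_of_lt_one hρ0 hρ1)
  -- Countably many lags `h` leave a single null set outside which all the formulas hold.
  filter_upwards [ae_all_iff.2 fun h => hW.condLaplace_add hβ hc hρ ht h hf,
    (hW.randomMeasure t ht).locFinite] with ω hω hfin
  -- The closed formula covers positive lags only, so lag `0` is discarded.
  rw [← tendsto_add_atTop_iff_nat 1]
  simp only [hω]
  have hmoeb := hf.tendsto_integral_moebius hfin (fun n => pow_nonneg hρ0 (n + 1)) hs0 hpow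
  simpa using hlog.neg.rexp.mul hmoeb.neg.rexp

end Transition

end MARG

theorem proposition5 {Θ : Type*} [MetricSpace Θ] [PolishSpace Θ] [MeasurableSpace Θ] [BorelSpace Θ]
    {Ω : Type*} [MeasurableSpace Ω] (P : Measure Ω) [IsProbabilityMeasure P]
    (H : Measure Θ) (βseq cseq : ℕ → ℝ) (W : ℕ → Ω → Measure Θ)
    (hW : MARG.IsMARG P H βseq cseq W)
    (β c ρ : ℝ) (hβ : ∀ t : ℕ, 1 ≤ t → βseq (t + 1) = β) (hc : ∀ t : ℕ, 1 ≤ t → cseq (t + 1) = c)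
    (hρ : ρ = β * c) (hρ1 : ρ < 1) :
    (∀ t : ℕ, 1 ≤ t → ∀ f : Θ → ℝ, MARG.BMPos f →
      ∀ᵐ ω ∂P, Tendsto (fun h : ℕ => MARG.condLaplace P (W (t + h)) (W t) f ω) atTop
        (𝓝 (Real.exp (-∫ θ, Real.log (1 + c / (1 - ρ) * f θ) ∂H)))) ∧
    (∀ t : ℕ, 1 ≤ t → MARG.IsGammaProcess P (W t) H ((1 - ρ) / c) →
      ∀ h : ℕ, 1 ≤ h → MARG.IsGammaProcess P (W (t + h)) H ((1 - ρ) / c)) := by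
  refine ⟨fun t ht f hf => hW.tendsto_condLaplace hβ hc hρ hρ1 ht hf, fun t ht hG h _ => ?_⟩
  induction h with
  | zero => exact hG
  | succ h ih =>
    rcases Nat.eq_zero_or_pos h with rfl | hpos
    · exact hW.isGammaProcess_succ hβ hc hρ hρ1 ht hG
    · exact hW.isGammaProcess_succ (t := t + h) hβ hc hρ hρ1 (by omega) (ih hpos)
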